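/- Let $G$ be a finite abstract simplicial complex, that is, a finite set of non-empty finite sets (simplices) closed under taking non-empty subsets. For $x\in G$ put $\dim x=|x|-1$, $\omega(x)=(-1)^{\dim x}$ and $W^-(x)=\{z\in G : z\subseteq x\}$, and for a set $A$ of simplices put $\chi(A)=\sum_{x\in A}\omega(x)$. Let $\omega(G)=\sum_{x,y\in G,\ x\cap y\neq\emptyset}\omega(x)\omega(y)$ (sum over ordered pairs) be the Wu characteristic. Let $L$ be the $G\times G$ matrix with $L(x,y)=1$ if $x\cap y\ne\emptyset$ and $L(x,y)=0$ otherwise, let $g=L^{-1}$, and let $M(x,y)=\omega(x)\omega(y)\,\chi(W^-(x)\cap W^-(y))$. The total energy of a matrix is the sum of all its entries. For a vertex $v$ define the energy curvature (the curvature of $\chi(G)-\omega(G)$) $$K(v)=\sum_{x\in G,\ v\in x}\frac{\omega(x)}{|x|}\;-\sum_{x,y\in G,\ v\in x\cap y}\frac{\omega(x)\omega(y)}{|x\cap y|}.$$ The link of a vertex $v$ is $\{x\in G : v\notin x,\ x\cup\{v\}\in G\}$, and $G-v$ is the complex of all simplices of $G$ not containing $v$. Inductively, a complex is contractible if it consists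 of one point, or if it has a vertex $v$ such that both the link of $v$ and $G-v$ are contractible. The $(-1)$-sphere is the empty complex; for $d\ge 0$, a $d$-sphere is a complex all of whose vertex links are $(d-1)$-spheres and for which $G-v$ is contractible for some vertex $v$. A $d$-ball is a $d$-sphere with one vertex removed (there is no $(-1)$-ball). For $d\geq 0$, a geometric $d$-complex without boundary is a complex in which all vertex links are $(d-1)$-spheres; a geometric $d$-complex with boundary is one in which every vertex link is a $(d-1)$-sphere or a $(d-1)$-ball, and its boundary vertices are those whose link is a $(d-1)$-ball. (For the clique complex of a finite simple graph, the link of $v$ is the clique complex of the unit sphere of $v$.) Proposition (total energy of $M-g$). 1. For every finite abstract simplicial complex $G$, the matrix $L$ is invertible and the total energy of $M-g$ is $\omega(G)-\chi(G)$; equivalently, the total energy of $g-M$ is $\chi(G)-\omega(G)$. 2. For every finite abstract simplicial complex $G$, $\sum_v K(v)=\chi(G)-\omega(G)$, where $v$ runs over the vertices of $G$. 3. If, for some $d\ge 0$, $G$ is a geometric $d$-complex without boundary, then the total energy of $M-g$ is $0$. 4. If, for some $d\ge 0$, $G$ is a geometric $d$-complex with boundary, then the energy curvature $K$ is supported on the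 boundary: $K(v)\neq 0$ implies that $v$ is a boundary vertex. -/

import Mathlib

namespace PreAbstractSimplicialComplex

variable {V : Type*}

/-- The dimension of a simplex (a nonempty finite set of vertices): one less than its size. -/
def simplexDim (x : Finset V) : ℕ := x.card - 1

/-- The sign `ω(x) = (-1)^{dim x}` of a simplex. -/
def simplexSign (x : Finset V) : ℝ := (-1) ^ simplexDim x

section Matrices

/-- The simplices of a complex on a finite vertex set form a finite type. -/
noncomputable instance fintypeSimplices [Fintype V] (G : PreAbstractSimplicialComplex V) :
    Fintype G := Fintype.ofFinite G

variable [Fintype V] [DecidableEq V]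

open Classical in
/-- The Euler characteristic `χ(A) = ∑_{x ∈ A} ω(x)` of an arbitrary set `A` of simplices. -/
noncomputable def eulerCharSet (A : Set (Finset V)) : ℝ :=
  ∑ x : Finset V with x ∈ A, simplexSign x

/-- The Euler characteristic `χ(G)`. -/
noncomputable def eulerChar (G : PreAbstractSimplicialComplex V) : ℝ := eulerCharSet G.faces

/-- The Wu characteristic: the sum of `ω(x) ω(y)` over all ordered pairs of intersecting
simplices. -/
noncomputable def wuChar (G : PreAbstractSimplicialComplex V) : ℝ :=
  ∑ x : G, ∑ y : G,
    if (x.1 ∩ y.1).Nonempty then simplexSign x.1 * simplexSign y.1 else 0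

/-- The dual star `W⁻(x)`: all simplices of `G` contained in `x`. -/
def dualStar (G : PreAbstractSimplicialComplex V) (x : Finset V) : Set (Finset V) :=
  {z | z ∈ G ∧ z ⊆ x}

/-- The connection Laplacian: `L(x,y) = 1` if `x` and `y` intersect, and `0` otherwise. -/
noncomputable def connectionMatrix (G : PreAbstractSimplicialComplex V) : Matrix G G ℝ :=
  Matrix.of fun x y => if (x.1 ∩ y.1).Nonempty then 1 else 0

/-- The Green function `g = L⁻¹`. -/
noncomputable def greenFunction (G : PreAbstractSimplicialComplex V) : Matrix G G ℝ :=
  (connectionMatrix G)⁻¹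

/-- The Wu matrix `M(x,y) = ω(x) ω(y) χ(W⁻(x) ∩ W⁻(y))`. -/
noncomputable def wuMatrix (G : PreAbstractSimplicialComplex V) : Matrix G G ℝ :=
  Matrix.of fun x y =>
    simplexSign x.1 * simplexSign y.1 * eulerCharSet (dualStar G x.1 ∩ dualStar G y.1)

/-- The total energy of a matrix indexed by the simplices: the sum of all its entries. -/
noncomputable def totalEnergy {G : PreAbstractSimplicialComplex V} (A : Matrix G G ℝ) : ℝ :=
  ∑ x, ∑ y, A x y

open Classical in
/-- The curvature of the Euler characteristic at `v`: every simplex distributes its sign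
`ω(x)` equally to its vertices. -/
noncomputable def eulerCurvature (G : PreAbstractSimplicialComplex V) (v : V) : ℝ :=
  ∑ x : G with v ∈ x.1, simplexSign x.1 / (x.1.card : ℝ)

open Classical in
/-- The curvature of the Wu characteristic at `v`: every ordered pair of intersecting simplices
distributes `ω(x) ω(y)` equally to the vertices of the simplex `x ∩ y`. -/
noncomputable def wuCurvature (G : PreAbstractSimplicialComplex V) (v : V) : ℝ :=
  ∑ x : G with v ∈ x.1, ∑ y : G with v ∈ y.1,
    simplexSign x.1 * simplexSign y.1 / ((x.1 ∩ y.1).card : ℝ)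

/-- The energy curvature: the curvature of `χ(G) - ω(G)`. -/
noncomputable def energyCurvature (G : PreAbstractSimplicialComplex V) (v : V) : ℝ :=
  eulerCurvature G v - wuCurvature G v

end Matrices

section Geometric

variable [DecidableEq V]

/-- The link of `v`. For the clique complex of a graph it is the clique complex of the
unit sphere of `v`, the subgraph induced on the neighbors of `v`. -/
def vertexLink (G : PreAbstractSimplicialComplex V) (v : V) : PreAbstractSimplicialComplex V where
  faces := {x | x.Nonempty ∧ v ∉ x ∧ insert v x ∈ G.faces}
  isRelLowerSet_faces := fun _ hx =>
    ⟨hx.1, fun _ hts ht => ⟨ht, fun hv => hx.2.1 (hts hv),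
      (G.isRelLowerSet_faces hx.2.2).2 (Finset.insert_subset_insert v hts)
        (Finset.insert_nonempty v _)⟩⟩

/-- The complex `G - v`: all simplices of `G` which do not contain `v`. -/
def deleteVertex (G : PreAbstractSimplicialComplex V) (v : V) :
    PreAbstractSimplicialComplex V where
  faces := {x | x ∈ G.faces ∧ v ∉ x}
  isRelLowerSet_faces := fun _ hx =>
    ⟨(G.isRelLowerSet_faces hx.1).1, fun _ hts ht =>
      ⟨(G.isRelLowerSet_faces hx.1).2 hts ht, fun hv => hx.2 (hts hv)⟩⟩

/-- Contractibility in the inductive combinatorial sense: a one-point complex is contractible,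
and `G` is contractible if it has a vertex `v` such that the link of `v` and `G - v` are. -/
inductive IsContractible : PreAbstractSimplicialComplex V → Prop
  | point (G : PreAbstractSimplicialComplex V) (v : V) (h : G.faces = {{v}}) : IsContractible G
  | step (G : PreAbstractSimplicialComplex V) (v : V) (hv : {v} ∈ G)
      (hlink : IsContractible (vertexLink G v)) (hdel : IsContractible (deleteVertex G v)) :
      IsContractible G

/-- `IsSphere n G` says that `G` is an `(n-1)`-sphere (the index is shifted by one). The
`(-1)`-sphere is the empty complex. For `d ≥ 0`, a `d`-sphere is a complex in which all vertex
links are `(d-1)`-spheres and which becomes contractible after removing some vertex. -/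
def IsSphere : ℕ → PreAbstractSimplicialComplex V → Prop
  | 0, G => G.faces = ∅
  | d + 1, G => (∀ v : V, {v} ∈ G → IsSphere d (vertexLink G v)) ∧
      ∃ v : V, {v} ∈ G ∧ IsContractible (deleteVertex G v)

/-- `IsBall n G` says that `G` is an `(n-1)`-ball (the index is shifted by one), that is, an
`(n-1)`-sphere from which one vertex has been removed. The removed vertex is called `none`. -/
def IsBall (n : ℕ) (G : PreAbstractSimplicialComplex V) : Prop :=
  ∃ S : PreAbstractSimplicialComplex (Option V),
    IsSphere n S ∧ {none} ∈ S ∧ deleteVertex S none = G.map some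

/-- A geometric `d`-complex without boundary: all vertex links are `(d-1)`-spheres. -/
def IsGeometric (d : ℕ) (G : PreAbstractSimplicialComplex V) : Prop :=
  ∀ v : V, {v} ∈ G → IsSphere d (vertexLink G v)

/-- A geometric `d`-complex with boundary: every vertex link is a `(d-1)`-sphere or
a `(d-1)`-ball. -/
def IsGeometricWithBoundary (d : ℕ) (G : PreAbstractSimplicialComplex V) : Prop :=
  ∀ v : V, {v} ∈ G → IsSphere d (vertexLink G v) ∨ IsBall d (vertexLink G v)

/-- The vertices of the boundary of a geometric `d`-complex: those with a `(d-1)`-ball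
as link. -/
def boundaryVertices (d : ℕ) (G : PreAbstractSimplicialComplex V) : Set V :=
  {v | {v} ∈ G ∧ IsBall d (vertexLink G v)}

end Geometric

end PreAbstractSimplicialComplex

namespace PreAbstractSimplicialComplex

variable {V : Type*}

/-! With `Z` the inclusion matrix of faces and `D` the diagonal matrix of signs, `L = Z D Zᵀ`,
because the non-empty subsets of `x ∩ y` have Euler characteristic 1 or 0 (`connectionMatrix_eq`).
`Z` is unitriangular and `D² = 1`, so `L` is invertible; `Z ω = 1` then gives `g` the energy `χ(G)`.
The same count makes `M(x,y) = ω(x) ω(y) L(x,y)`, with energy `ω(G)`.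

For the curvature, expanding `1/|x ∩ y|` over the sets `c` with `v ∈ c ⊆ x ∩ y` turns the Wu
curvature into the sum of `ω(c)/|c| · (∑_{x ⊇ c} ω(x))²` (`wuCurvature_eq_sum_sq`). Up to sign the
inner sum is `1 - χ` of an iterated link. If the link of `v` is a sphere it is `±1`
(`IsSphere.cofaceSum_sq`), so the Wu and Euler curvatures agree at `v`. -/

lemma simplexSign_mul_self (x : Finset V) : simplexSign x * simplexSign x = 1 := by
  rw [simplexSign, ← mul_pow]; norm_num

lemma simplexSign_eq_neg {x : Finset V} (hx : x.Nonempty) :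
    simplexSign x = -(-1) ^ x.card := by
  obtain ⟨n, hn⟩ := Nat.exists_eq_succ_of_ne_zero hx.card_pos.ne'
  simp [simplexSign, simplexDim, hn, pow_succ]

lemma mem_faces_iff (G : PreAbstractSimplicialComplex V) {x : Finset V} :
    x ∈ G.faces ↔ x ∈ G := Iff.rfl

lemma nonempty_of_mem (G : PreAbstractSimplicialComplex V) {x : Finset V} (hx : x ∈ G) :
    x.Nonempty := (G.isRelLowerSet_faces hx).1

lemma mem_of_subset (G : PreAbstractSimplicialComplex V) {x y : Finset V} (hx : x ∈ G)
    (hyx : y ⊆ x) (hy : y.Nonempty) : y ∈ G := (G.isRelLowerSet_faces hx).2 hyx hy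

open Classical in
lemma sum_coe_eq_sum_filter [Fintype V] (G : PreAbstractSimplicialComplex V) (f : Finset V → ℝ) :
    ∑ x : G, f x.1 = ∑ x : Finset V with x ∈ G, f x :=
  (Finset.sum_subtype _ (by simp) f).symm

lemma eulerChar_eq_sum [Fintype V] (G : PreAbstractSimplicialComplex V) :
    G.eulerChar = ∑ x : G, simplexSign x.1 := by
  classical
  rw [sum_coe_eq_sum_filter, eulerChar, eulerCharSet]
  exact Finset.sum_congr (by ext; simp [mem_faces_iff]) fun _ _ => rfl

lemma totalEnergy_eq_dotProduct [Fintype V] {G : PreAbstractSimplicialComplex V} (A : Matrix G G ℝ) :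
    totalEnergy A = dotProduct 1 (A.mulVec 1) := by
  simp [totalEnergy, dotProduct, Matrix.mulVec]

/-! ### Alternating sums over the subsets of a finite set. -/

section Subsets

variable [DecidableEq V]

/-- A full simplex has Euler characteristic `1`, the empty one `0`. -/
lemma sum_simplexSign_nonempty_subsets (s : Finset V) :
    ∑ z ∈ s.powerset with z.Nonempty, simplexSign z = if s.Nonempty then 1 else 0 := by
  have h := Finset.sum_powerset_neg_one_pow_card (x := s)
  have h' : ∑ z ∈ s.powerset, ((-1 : ℝ)) ^ z.card = if s = ∅ then 1 else 0 := by
    exact_mod_cast h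
  rw [← Finset.sum_filter_add_sum_filter_not _ (fun z : Finset V => z.Nonempty)] at h'
  have h1 : (s.powerset.filter fun z => ¬ z.Nonempty) = {∅} := by
    ext z; simp [Finset.not_nonempty_iff_eq_empty]; rintro rfl; simp
  rw [h1, Finset.sum_singleton, Finset.card_empty, pow_zero] at h'
  have h2 : ∑ z ∈ s.powerset with z.Nonempty, simplexSign z
      = -∑ z ∈ s.powerset with z.Nonempty, (-1 : ℝ) ^ z.card := by
    rw [← Finset.sum_neg_distrib]
    exact Finset.sum_congr rfl fun z hz => simplexSign_eq_neg (Finset.mem_filter.1 hz).2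
  rw [h2]
  rcases s.eq_empty_or_nonempty with rfl | hs
  · simp at h' ⊢; linarith
  · simp [hs, hs.ne_empty] at h' ⊢; linarith

/-- The binomial identity `1 / |s| = ∑ (-1)^{|c| - 1} / |c|` over the sets `c` with
`v ∈ c ⊆ s`. -/
lemma sum_simplexSign_div_card {s : Finset V} {v : V} (hv : v ∈ s) :
    ∑ c ∈ s.powerset with v ∈ c, simplexSign c / (c.card : ℝ) = 1 / (s.card : ℝ) := by
  -- Removing `v` from `c` lowers its size by one and leaves an arbitrary subset of `s.erase v`.
  have h1 : ∑ c ∈ s.powerset with v ∈ c, simplexSign c / (c.card : ℝ)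
      = ∑ c ∈ (s.erase v).powerset, (-1 : ℝ) ^ c.card / ((c.card : ℝ) + 1) := by
    symm
    refine Finset.sum_bij' (fun c _ => insert v c) (fun c _ => c.erase v) ?_ ?_ ?_ ?_ ?_
    · intro c hc
      rw [Finset.mem_powerset, Finset.subset_erase] at hc
      simp [Finset.insert_subset_iff, hv, hc.1]
    · intro c hc
      simp only [Finset.mem_filter, Finset.mem_powerset] at hc
      exact Finset.mem_powerset.2 (Finset.erase_subset_erase v hc.1)
    · intro c hc
      rw [Finset.mem_powerset, Finset.subset_erase] at hc
      exact Finset.erase_insert hc.2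
    · intro c hc
      exact Finset.insert_erase (Finset.mem_filter.1 hc).2
    · intro c hc
      rw [Finset.mem_powerset, Finset.subset_erase] at hc
      simp [simplexSign, simplexDim, Finset.card_insert_of_notMem hc.2]
  have h2 : s.card = (s.erase v).card + 1 := (Finset.card_erase_add_one hv).symm
  rw [h1, h2]
  generalize (s.erase v) = t
  rw [Finset.sum_powerset_apply_card (fun k => (-1 : ℝ) ^ k / ((k : ℝ) + 1))]
  set n := t.card
  have hn : ((n : ℝ) + 1) ≠ 0 := by positivity
  -- Absorption `(n+1) C(n,k) = (k+1) C(n+1,k+1)` makes the denominator independent of `k`.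
  have h3 : ∀ k ∈ Finset.range (n + 1), n.choose k • ((-1 : ℝ) ^ k / ((k : ℝ) + 1))
      = -(1 / ((n : ℝ) + 1)) * ((-1) ^ (k + 1) * ((n + 1).choose (k + 1) : ℝ)) := by
    intro k _
    have hk : ((k : ℝ) + 1) ≠ 0 := by positivity
    have := Nat.add_one_mul_choose_eq n k
    have h : ((n : ℝ) + 1) * (n.choose k : ℝ) = ((n + 1).choose (k + 1) : ℝ) * ((k : ℝ) + 1) := by
      exact_mod_cast this
    rw [nsmul_eq_mul]
    field_simp
    rw [pow_succ]
    linear_combination ((-1 : ℝ) ^ k) * h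
  rw [Finset.sum_congr rfl h3, ← Finset.mul_sum]
  -- The full alternating row vanishes and its term at 0 is 1, so the remaining terms sum to -1.
  have h4 : ∑ m ∈ Finset.range (n + 1 + 1), ((-1 : ℝ) ^ m * ((n + 1).choose m : ℝ)) = 0 := by
    exact_mod_cast Int.alternating_sum_range_choose_of_ne (Nat.succ_ne_zero n)
  rw [Finset.sum_range_succ'] at h4
  have h5 : ∑ k ∈ Finset.range (n + 1), ((-1 : ℝ) ^ (k + 1) * ((n + 1).choose (k + 1) : ℝ))
      = -1 := by
    simp only [pow_zero, Nat.choose_zero_right, Nat.cast_one, mul_one] at h4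
    linarith
  rw [h5]
  push_cast
  ring

end Subsets

/-! ### Energies of the Wu matrix and of the Green function. -/

section Finite

variable [Fintype V] [DecidableEq V]

/-- Summing signs over all faces of `G` inside a set `s` all of whose nonempty subsets are
faces. -/
lemma sum_simplexSign_subset (G : PreAbstractSimplicialComplex V) {s : Finset V}
    (hs : ∀ z ⊆ s, z.Nonempty → z ∈ G) :
    ∑ z : G, (if z.1 ⊆ s then simplexSign z.1 else 0) = if s.Nonempty then 1 else 0 := by
  classical
  rw [← sum_simplexSign_nonempty_subsets, sum_coe_eq_sum_filter G
    (fun z => if z ⊆ s then simplexSign z else 0), ← Finset.sum_filter, Finset.filter_filter]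
  refine Finset.sum_congr ?_ fun _ _ => rfl
  ext z
  simp only [Finset.mem_filter, Finset.mem_univ, true_and, Finset.mem_powerset]
  exact ⟨fun h => ⟨h.2, G.nonempty_of_mem h.1⟩, fun h => ⟨hs z h.1 h.2, h.1⟩⟩

/-- The simplices below both `x` and `y` are exactly the non-empty subsets of `x ∩ y`. -/
lemma eulerCharSet_dualStar_inter (G : PreAbstractSimplicialComplex V) (x y : G) :
    eulerCharSet (dualStar G x.1 ∩ dualStar G y.1) = G.connectionMatrix x y := by
  classical
  rw [connectionMatrix, Matrix.of_apply, ← sum_simplexSign_nonempty_subsets, eulerCharSet]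
  refine Finset.sum_congr ?_ fun _ _ => rfl
  ext z
  simp only [dualStar, Finset.mem_filter, Finset.mem_univ, true_and, Finset.mem_powerset,
    Set.mem_inter_iff, Set.mem_ofPred_eq, Finset.subset_inter_iff]
  exact ⟨fun h => ⟨⟨h.1.2, h.2.2⟩, G.nonempty_of_mem h.1.1⟩, fun h =>
    ⟨⟨G.mem_of_subset x.2 h.1.1 h.2, h.1.1⟩, G.mem_of_subset x.2 h.1.1 h.2, h.1.2⟩⟩

lemma totalEnergy_wuMatrix (G : PreAbstractSimplicialComplex V) :
    totalEnergy G.wuMatrix = G.wuChar := by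
  refine Finset.sum_congr rfl fun x _ => Finset.sum_congr rfl fun y _ => ?_
  rw [wuMatrix, Matrix.of_apply, eulerCharSet_dualStar_inter, connectionMatrix, Matrix.of_apply]
  split_ifs <;> simp

/-- The transposed zeta matrix of the face poset. -/
noncomputable def zetaMatrix (G : PreAbstractSimplicialComplex V) : Matrix G G ℝ :=
  Matrix.of fun x z => if z.1 ⊆ x.1 then 1 else 0

/-- The diagonal matrix of the signs of the simplices. -/
noncomputable def signMatrix (G : PreAbstractSimplicialComplex V) : Matrix G G ℝ :=
  open Classical in Matrix.diagonal fun x => simplexSign x.1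

open Classical in
lemma connectionMatrix_eq (G : PreAbstractSimplicialComplex V) :
    G.connectionMatrix = G.zetaMatrix * G.signMatrix * G.zetaMatrix.transpose := by
  ext x y
  rw [signMatrix, Matrix.mul_apply]
  simp only [Matrix.mul_diagonal, Matrix.transpose_apply, zetaMatrix, Matrix.of_apply]
  rw [connectionMatrix, Matrix.of_apply, ← sum_simplexSign_subset G (s := x.1 ∩ y.1)
    fun z hz h => G.mem_of_subset x.2 (hz.trans Finset.inter_subset_left) h]
  refine Finset.sum_congr rfl fun z _ => ?_
  by_cases h1 : z.1 ⊆ x.1 <;> by_cases h2 : z.1 ⊆ y.1 <;> simp [Finset.subset_inter_iff, h1, h2]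

open Classical in
-- Ordered by cardinality the matrix is triangular with unit diagonal; strong induction on the size
-- of `x` shows that its kernel is trivial.
lemma isUnit_zetaMatrix (G : PreAbstractSimplicialComplex V) : IsUnit G.zetaMatrix := by
  rw [← Matrix.mulVec_injective_iff_isUnit]
  refine (injective_iff_map_eq_zero (Matrix.mulVecLin G.zetaMatrix)).2 fun u hu => ?_
  have key : ∀ n, ∀ x : G, x.1.card = n → u x = 0 := by
    intro n
    induction n using Nat.strong_induction_on with
    | _ n ih =>
      intro x hx
      have h := congrFun hu x
      simp only [Matrix.mulVecLin_apply, Matrix.mulVec, dotProduct, zetaMatrix, Matrix.of_apply,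
        Pi.zero_apply] at h
      rw [Finset.sum_eq_single x] at h
      · simpa using h
      · intro z _ hzx
        by_cases hz : z.1 ⊆ x.1
        · rw [ih _ (hx ▸ Finset.card_lt_card (hz.ssubset_of_ne fun e => hzx (Subtype.ext e))) z rfl,
            mul_zero]
        · simp [hz]
      · simp
  exact funext fun x => key _ x rfl

open Classical in
lemma isUnit_signMatrix (G : PreAbstractSimplicialComplex V) : IsUnit G.signMatrix :=
  IsUnit.of_mul_eq_one G.signMatrix (by
    rw [signMatrix, Matrix.diagonal_mul_diagonal]
    simp [simplexSign_mul_self])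

lemma isUnit_connectionMatrix (G : PreAbstractSimplicialComplex V) :
    IsUnit G.connectionMatrix := by
  classical
  have h : IsUnit (G.zetaMatrix * G.signMatrix * G.zetaMatrix.transpose) :=
    (G.isUnit_zetaMatrix.mul G.isUnit_signMatrix).mul
      ((Matrix.isUnit_transpose _).2 G.isUnit_zetaMatrix)
  rw [connectionMatrix_eq]
  convert h

open Classical in
lemma zetaMatrix_mulVec_simplexSign (G : PreAbstractSimplicialComplex V) :
    G.zetaMatrix.mulVec (fun x => simplexSign x.1) = 1 := by
  ext x
  have h := sum_simplexSign_subset G (s := x.1) fun z hz h => G.mem_of_subset x.2 hz h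
  rw [if_pos (G.nonempty_of_mem x.2)] at h
  simpa [Matrix.mulVec, dotProduct, zetaMatrix] using h

lemma totalEnergy_greenFunction (G : PreAbstractSimplicialComplex V) :
    totalEnergy G.greenFunction = G.eulerChar := by
  classical
  -- If `Zᵀ u = 1`, then `L u = Z D 1 = Z ω = 1`, so `u = g 1`.
  obtain ⟨u, hu⟩ := (Matrix.mulVec_surjective_iff_isUnit.2
    ((Matrix.isUnit_transpose _).2 G.isUnit_zetaMatrix)) (1 : G → ℝ)
  have hL : G.connectionMatrix.mulVec u = 1 := by
    rw [connectionMatrix_eq, ← Matrix.mulVec_mulVec, hu, ← Matrix.mulVec_mulVec]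
    rw [← zetaMatrix_mulVec_simplexSign]
    refine congrArg _ ?_
    rw [zetaMatrix_mulVec_simplexSign]
    ext x
    simp [signMatrix, Matrix.mulVec_diagonal]
  have hg : G.greenFunction.mulVec 1 = u := by
    rw [← hL, greenFunction, Matrix.mulVec_mulVec, Matrix.nonsing_inv_mul _
      ((Matrix.isUnit_iff_isUnit_det _).1 G.isUnit_connectionMatrix), Matrix.one_mulVec]
  rw [totalEnergy_eq_dotProduct, hg]
  -- The energy is `1 · u = (Z ω) · u = ω · (Zᵀ u) = ω · 1`.
  rw [← zetaMatrix_mulVec_simplexSign, dotProduct_comm, Matrix.dotProduct_mulVec,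
    ← Matrix.mulVec_transpose, hu, eulerChar_eq_sum]
  simp [dotProduct]

lemma totalEnergy_wuMatrix_sub_greenFunction (G : PreAbstractSimplicialComplex V) :
    totalEnergy (G.wuMatrix - G.greenFunction) = G.wuChar - G.eulerChar := by
  rw [← totalEnergy_wuMatrix, ← totalEnergy_greenFunction]
  simp [totalEnergy, Finset.sum_sub_distrib]

/-! ### Gauss–Bonnet for the Euler, Wu and energy curvatures. -/

lemma sum_ite_mem_div_card (s : Finset V) (a : ℝ) :
    ∑ v : V, (if v ∈ s then a / (s.card : ℝ) else 0) = if s.Nonempty then a else 0 := by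
  rw [← Finset.sum_filter, Finset.sum_const, Finset.filter_univ_mem, nsmul_eq_mul]
  rcases s.eq_empty_or_nonempty with rfl | hs
  · simp
  · have : (s.card : ℝ) ≠ 0 := by exact_mod_cast hs.card_pos.ne'
    rw [if_pos hs]; field_simp

lemma sum_eulerCurvature (G : PreAbstractSimplicialComplex V) :
    ∑ v : V, G.eulerCurvature v = G.eulerChar := by
  simp only [eulerCurvature, Finset.sum_filter]
  rw [Finset.sum_comm, eulerChar_eq_sum]
  refine Finset.sum_congr rfl fun x _ => ?_
  have h := sum_ite_mem_div_card x.1 (simplexSign x.1)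
  rw [if_pos (G.nonempty_of_mem x.2)] at h
  convert h

lemma wuCurvature_eq (G : PreAbstractSimplicialComplex V) (v : V) :
    G.wuCurvature v = ∑ x : G, ∑ y : G, if v ∈ x.1 ∩ y.1 then
      simplexSign x.1 * simplexSign y.1 / ((x.1 ∩ y.1).card : ℝ) else 0 := by
  simp only [wuCurvature, Finset.sum_filter]
  refine Finset.sum_congr rfl fun x _ => ?_
  by_cases hx : v ∈ x.1
  · simp [hx]
  · simp [hx]

lemma sum_wuCurvature (G : PreAbstractSimplicialComplex V) :
    ∑ v : V, G.wuCurvature v = G.wuChar := by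
  simp only [wuCurvature_eq]
  rw [Finset.sum_comm]
  refine Finset.sum_congr rfl fun x _ => ?_
  rw [Finset.sum_comm]
  exact Finset.sum_congr rfl fun y _ => sum_ite_mem_div_card _ _

lemma sum_energyCurvature (G : PreAbstractSimplicialComplex V) :
    ∑ v : V, G.energyCurvature v = G.eulerChar - G.wuChar := by
  simp [energyCurvature, Finset.sum_sub_distrib, sum_eulerCurvature, sum_wuCurvature]

/-! ### Coface sums in links, contractible complexes and spheres. -/

open Classical in
/-- The alternating sum over the faces of `G` that contain `c`, the empty face included. -/
noncomputable def cofaceSum (G : PreAbstractSimplicialComplex V) (c : Finset V) : ℝ :=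
  ∑ x : Finset V with (x ∈ G ∨ x = ∅) ∧ c ⊆ x, (-1) ^ x.card

/-- Adding `v` matches faces of the link with faces of `G` through `v`, and the extra vertex flips
the sign. The empty face of the link corresponds to `{v}`, which is why it is counted. -/
lemma cofaceSum_insert (G : PreAbstractSimplicialComplex V) {v : V} (hv : {v} ∈ G)
    {c : Finset V} (hc : v ∉ c) :
    G.cofaceSum (insert v c) = -(G.vertexLink v).cofaceSum c := by
  have hlink : ∀ x, x ∈ G.vertexLink v ↔ x.Nonempty ∧ v ∉ x ∧ insert v x ∈ G := fun x => Iff.rfl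
  have key : ∀ x, (x ∈ G.vertexLink v ∨ x = ∅) ↔ v ∉ x ∧ insert v x ∈ G := by
    intro x
    rw [hlink]
    rcases x.eq_empty_or_nonempty with rfl | hx
    · simpa using hv
    · simp [hx, hx.ne_empty]
  rw [cofaceSum, cofaceSum, ← Finset.sum_neg_distrib]
  symm
  refine Finset.sum_bij' (fun x _ => insert v x) (fun x _ => x.erase v) ?_ ?_ ?_ ?_ ?_
  · intro x hx
    simp only [Finset.mem_filter, Finset.mem_univ, true_and, key] at hx ⊢
    exact ⟨Or.inl hx.1.2, Finset.insert_subset_insert v hx.2⟩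
  · intro x hx
    simp only [Finset.mem_filter, Finset.mem_univ, true_and, key] at hx ⊢
    have hvx : v ∈ x := hx.2 (Finset.mem_insert_self v c)
    rw [Finset.insert_erase hvx]
    exact ⟨⟨Finset.notMem_erase v x, hx.1.resolve_right (Finset.ne_empty_of_mem hvx)⟩,
      Finset.subset_erase.2 ⟨(Finset.subset_insert v c).trans hx.2, hc⟩⟩
  · intro x hx
    simp only [Finset.mem_filter, Finset.mem_univ, true_and, key] at hx
    exact Finset.erase_insert hx.1.1
  · intro x hx
    simp only [Finset.mem_filter, Finset.mem_univ, true_and] at hx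
    exact Finset.insert_erase (hx.2 (Finset.mem_insert_self v c))
  · intro x hx
    simp only [Finset.mem_filter, Finset.mem_univ, true_and, key] at hx
    rw [Finset.card_insert_of_notMem hx.1.1, pow_succ]
    ring

/-- Faces are split by whether they contain `v`. Since the coface sum at `∅` is `1 - χ`, this is the
recursion for the Euler characteristic under vertex deletion. -/
lemma cofaceSum_empty_eq_sub (G : PreAbstractSimplicialComplex V) {v : V} (hv : {v} ∈ G) :
    G.cofaceSum ∅ = (G.deleteVertex v).cofaceSum ∅ - (G.vertexLink v).cofaceSum ∅ := by
  classical
  have h := cofaceSum_insert G hv (Finset.notMem_empty v)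
  rw [sub_eq_add_neg, ← h, cofaceSum, cofaceSum, cofaceSum,
    ← Finset.sum_filter_not_add_sum_filter _ (fun x : Finset V => v ∈ x)]
  congr 1
  · refine Finset.sum_congr ?_ fun _ _ => rfl
    have hdel : ∀ x, x ∈ G.deleteVertex v ↔ x ∈ G ∧ v ∉ x := fun x => Iff.rfl
    ext x
    simp only [Finset.mem_filter, Finset.mem_univ, true_and, Finset.empty_subset, and_true, hdel]
    constructor
    · rintro ⟨h | h, h'⟩
      exacts [Or.inl ⟨h, h'⟩, Or.inr h]
    · rintro (h | rfl)
      exacts [⟨Or.inl h.1, h.2⟩, ⟨Or.inr rfl, Finset.notMem_empty v⟩]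
  · refine Finset.sum_congr ?_ fun _ _ => rfl
    ext x
    simp

lemma IsContractible.cofaceSum_empty {G : PreAbstractSimplicialComplex V}
    (h : G.IsContractible) : G.cofaceSum ∅ = 0 := by
  induction h with
  | point G v h =>
    classical
    have : (Finset.univ.filter fun x : Finset V => (x ∈ G ∨ x = ∅) ∧ ∅ ⊆ x) = {{v}, ∅} := by
      ext x
      have hx : x ∈ G ↔ x = {v} := by rw [← G.mem_faces_iff, h, Set.mem_singleton_iff]
      simp [hx]
    rw [cofaceSum]
    refine (Finset.sum_congr (by convert this) fun _ _ => rfl).trans ?_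
    rw [Finset.sum_pair (Finset.singleton_ne_empty v)]
    simp
  | step G v hv _ _ h1 h2 => rw [cofaceSum_empty_eq_sub G hv, h1, h2, sub_zero]

/-- Deleting a suitable vertex leaves a contractible complex, which contributes 0, so only the link,
a smaller sphere, remains. Squaring discards the sign, which alternates with dimension. -/
lemma IsSphere.cofaceSum_empty_sq {d : ℕ} {G : PreAbstractSimplicialComplex V}
    (h : IsSphere d G) : G.cofaceSum ∅ ^ 2 = 1 := by
  induction d generalizing G with
  | zero =>
    have hG : ∀ x, x ∉ G := fun x hx => by
      rw [← G.mem_faces_iff, show G.faces = ∅ from h] at hx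
      exact hx
    have h1 : G.cofaceSum ∅ = 1 := by
      simp [cofaceSum, hG, Finset.filter_eq']
    rw [h1, one_pow]
  | succ d ih =>
    obtain ⟨h1, v, hv, hc⟩ := h
    rw [cofaceSum_empty_eq_sub G hv, hc.cofaceSum_empty, zero_sub, neg_sq, ih (h1 v hv)]

/-- Each vertex of `c` is peeled off by passing to its link, again a sphere, until `c` is empty. -/
lemma IsSphere.cofaceSum_sq {d : ℕ} {G : PreAbstractSimplicialComplex V}
    (h : IsSphere d G) {c : Finset V} (hc : c ∈ G ∨ c = ∅) : G.cofaceSum c ^ 2 = 1 := by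
  induction c using Finset.induction_on generalizing G d with
  | empty => exact h.cofaceSum_empty_sq
  | insert w c hw ih =>
    have hcG : insert w c ∈ G := hc.resolve_right (Finset.insert_ne_empty w c)
    have hwG : {w} ∈ G := G.mem_of_subset hcG (by simp) (Finset.singleton_nonempty w)
    rw [cofaceSum_insert G hwG hw, neg_sq]
    cases d with
    | zero =>
      rw [← G.mem_faces_iff, show G.faces = ∅ from h] at hcG
      exact hcG.elim
    | succ d =>
      refine ih (h.1 w hwG) ?_
      rcases c.eq_empty_or_nonempty with rfl | hne
      · exact Or.inr rfl
      · exact Or.inl ⟨hne, hw, hcG⟩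

/-! ### Wu curvature through coface sums, and vanishing of the energy curvature. -/

lemma sum_simplexSign_cofaces (G : PreAbstractSimplicialComplex V) {c : Finset V}
    (hc : c.Nonempty) :
    ∑ x : G, (if c ⊆ x.1 then simplexSign x.1 else 0) = -G.cofaceSum c := by
  classical
  rw [sum_coe_eq_sum_filter G (fun x => if c ⊆ x then simplexSign x else 0), ← Finset.sum_filter,
    Finset.filter_filter, cofaceSum, ← Finset.sum_neg_distrib]
  refine Finset.sum_congr ?_ fun x hx => ?_
  · ext x
    simp only [Finset.mem_filter, Finset.mem_univ, true_and]
    refine and_congr_left fun hcx => (or_iff_left ?_).symm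
    exact (hc.mono hcx).ne_empty
  · exact simplexSign_eq_neg (hc.mono (Finset.mem_filter.1 hx).2.2)

/-- The Wu curvature as a weighted sum over the simplices `c` containing `v`. -/
lemma wuCurvature_eq_sum_sq (G : PreAbstractSimplicialComplex V) (v : V) :
    G.wuCurvature v = ∑ c : G, if v ∈ c.1 then
      simplexSign c.1 / (c.1.card : ℝ) * G.cofaceSum c.1 ^ 2 else 0 := by
  classical
  have h1 : ∀ x y : G, (if v ∈ x.1 ∩ y.1 then
      simplexSign x.1 * simplexSign y.1 / ((x.1 ∩ y.1).card : ℝ) else 0)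
      = ∑ c : G, if v ∈ c.1 then simplexSign c.1 / (c.1.card : ℝ) *
        ((if c.1 ⊆ x.1 then simplexSign x.1 else 0) *
          (if c.1 ⊆ y.1 then simplexSign y.1 else 0)) else 0 := by
    intro x y
    split_ifs with hv
    -- The binomial identity expands `1/|x ∩ y|`; the sum over `c` then extends to all of `G`, since
    -- the added terms vanish.
    · rw [div_eq_mul_one_div, ← sum_simplexSign_div_card hv, Finset.mul_sum,
        sum_coe_eq_sum_filter G (fun c => if v ∈ c then simplexSign c / (c.card : ℝ) *
        ((if c ⊆ x.1 then simplexSign x.1 else 0) *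
          (if c ⊆ y.1 then simplexSign y.1 else 0)) else 0)]
      refine Finset.sum_subset_zero_on_sdiff ?_ ?_ ?_
      · intro c hc
        simp only [Finset.mem_filter, Finset.mem_univ, true_and, Finset.mem_powerset] at hc ⊢
        exact G.mem_of_subset x.2 (hc.1.trans Finset.inter_subset_left) ⟨v, hc.2⟩
      · intro c hc
        simp only [Finset.mem_sdiff, Finset.mem_filter, Finset.mem_univ, true_and,
          Finset.mem_powerset, Finset.subset_inter_iff] at hc
        by_cases hvc : v ∈ c <;> by_cases hx : c ⊆ x.1 <;> by_cases hy : c ⊆ y.1 <;> simp_all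
      · intro c hc
        simp only [Finset.mem_filter, Finset.mem_powerset, Finset.subset_inter_iff] at hc
        simp only [hc, if_true]
        ring
    · symm
      refine Finset.sum_eq_zero fun c _ => ?_
      rw [Finset.mem_inter] at hv
      split_ifs with h1 h2 h3 <;> try simp
      exact absurd ⟨h2 h1, h3 h1⟩ hv
  rw [wuCurvature_eq]
  simp only [h1]
  have h2 : ∀ x : G, ∑ y : G, ∑ c : G, (if v ∈ c.1 then simplexSign c.1 / (c.1.card : ℝ) *
        ((if c.1 ⊆ x.1 then simplexSign x.1 else 0) *
          (if c.1 ⊆ y.1 then simplexSign y.1 else 0)) else 0)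
      = ∑ c : G, ∑ y : G, (if v ∈ c.1 then simplexSign c.1 / (c.1.card : ℝ) *
        ((if c.1 ⊆ x.1 then simplexSign x.1 else 0) *
          (if c.1 ⊆ y.1 then simplexSign y.1 else 0)) else 0) := fun x => Finset.sum_comm
  simp only [h2]
  rw [Finset.sum_comm]
  refine Finset.sum_congr rfl fun c _ => ?_
  split_ifs with hv
  -- For fixed `c` the sums over `x` and `y` are independent and equal, hence the square.
  · rw [← neg_sq, ← sum_simplexSign_cofaces G ⟨v, hv⟩, sq, Finset.sum_mul_sum, Finset.mul_sum]
    simp only [Finset.mul_sum]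
  · simp

/-- The energy curvature vanishes at a vertex whose link is a sphere. -/
lemma energyCurvature_eq_zero_of_isSphere (G : PreAbstractSimplicialComplex V) {v : V} {d : ℕ}
    (hv : {v} ∈ G) (h : IsSphere d (G.vertexLink v)) : G.energyCurvature v = 0 := by
  classical
  rw [energyCurvature, sub_eq_zero, wuCurvature_eq_sum_sq, eulerCurvature, Finset.sum_filter]
  refine Finset.sum_congr rfl fun c _ => ?_
  by_cases hc : v ∈ c.1
  · have hsq : G.cofaceSum c.1 ^ 2 = 1 := by
      rw [← Finset.insert_erase hc, cofaceSum_insert G hv (Finset.notMem_erase v c.1), neg_sq]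
      refine h.cofaceSum_sq ?_
      rcases (c.1.erase v).eq_empty_or_nonempty with h0 | hne
      · exact Or.inr h0
      · refine Or.inl ⟨hne, Finset.notMem_erase v c.1, ?_⟩
        rw [Finset.insert_erase hc]
        exact c.2
    simp [hc, hsq]
  · simp [hc]

/-- Points of `V` need not be vertices of `G`; this disposes of the others in sums over `V`. -/
lemma energyCurvature_eq_zero_of_notMem (G : PreAbstractSimplicialComplex V) {v : V}
    (hv : {v} ∉ G) : G.energyCurvature v = 0 := by
  have h : ∀ x : G, v ∉ x.1 := fun x hx =>
    hv (G.mem_of_subset x.2 (Finset.singleton_subset_iff.2 hx) (Finset.singleton_nonempty v))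
  simp [energyCurvature, eulerCurvature, wuCurvature, h]

end Finite

end PreAbstractSimplicialComplex

theorem mainTheorem11 {V : Type*} [Fintype V] [DecidableEq V]
    (G : PreAbstractSimplicialComplex V) :
    IsUnit G.connectionMatrix ∧
    PreAbstractSimplicialComplex.totalEnergy (G.wuMatrix - G.greenFunction)
      = G.wuChar - G.eulerChar ∧
    ∑ v : V, G.energyCurvature v = G.eulerChar - G.wuChar ∧
    (∀ d : ℕ, G.IsGeometric d →
      PreAbstractSimplicialComplex.totalEnergy (G.wuMatrix - G.greenFunction) = 0) ∧
    (∀ d : ℕ, G.IsGeometricWithBoundary d →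
      ∀ v : V, G.energyCurvature v ≠ 0 → v ∈ G.boundaryVertices d) := by
  refine ⟨G.isUnit_connectionMatrix, G.totalEnergy_wuMatrix_sub_greenFunction,
    G.sum_energyCurvature, fun d hd => ?_, fun d hd v hK => ?_⟩
  · rw [G.totalEnergy_wuMatrix_sub_greenFunction, ← neg_sub, ← G.sum_energyCurvature,
      Finset.sum_eq_zero, neg_zero]
    intro v _
    by_cases hv : {v} ∈ G
    · exact G.energyCurvature_eq_zero_of_isSphere hv (hd v hv)
    · exact G.energyCurvature_eq_zero_of_notMem hv
  · have hv : {v} ∈ G := by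
      by_contra hv
      exact hK (G.energyCurvature_eq_zero_of_notMem hv)
    exact ⟨hv, (hd v hv).resolve_left
      fun h => hK (G.energyCurvature_eq_zero_of_isSphere hv h)⟩
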